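/- Let $\Omega\subset\mathbb{R}^d$ be a bounded open set with $C^2$ boundary, i.e. every $p\in\partial\Omega$ has a neighbourhood $U$ and a $C^2$ function $\varphi:U\to\mathbb{R}$ with $\varphi(p)=0$, $\nabla\varphi(p)\neq 0$ and $\Omega\cap U=\{x\in U:\varphi(x)<0\}$; the outward unit normal at $p$ is $\nabla\varphi(p)/\|\nabla\varphi(p)\|$. Then there are constants $C>0$ and $h_0>0$, depending only on $\Omega$, such that the following holds for every $0<h\le h_0$. Let $K^1,\dots,K^m$ be a finite mesh of measurable elements (subelements, if the elements have been subdivided) that overlap only in null sets and cover $\Omega$ up to a null set, and let each $K^e$ have a centroid $x_e$ in its convex hull. Suppose that every $K^e$ has diameter at most $h$; elements contained in the open ball about $x_e$ of radius $\operatorname{dist}(x_e,\partial\Omega)$, which adaptive subdivision does not subdivide further, may be of any size. For every $e$ let $x_p^e\in\partial\Omega$ be a boundary point closest to $x_e$ (any one, if there are several), let $n_p^e$ be the outward unit normal to $\Omega$ at $x_p^e$, and replace $\Omega$ inside $K^e$ by the half-space $H^e=\{x:(x-x_p^e)\cdot n_p^e\le 0\}$. Then, with $V_{\mathrm{exact}}=|\Omega|$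 and $V_h=\sum_{e=1}^m|K^e\cap H^e|$ (Lebesgue measure), $$|V_{\mathrm{exact}}-V_h|\le C h^2 .$$ -/

import Mathlib

open MeasureTheory Metric Topology

noncomputable section

namespace VolumeInsertion

/-- `φ` is a `C²` local defining function of `Ω` near the point `p`: it is twice continuously
differentiable near `p`, vanishes at `p` with nonzero gradient, and near `p` the set `Ω` is
exactly `{φ < 0}`. -/
structure IsLocalDefiningFunction {d : ℕ} (Ω : Set (EuclideanSpace ℝ (Fin d)))
    (p : EuclideanSpace ℝ (Fin d)) (φ : EuclideanSpace ℝ (Fin d) → ℝ) : Prop where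
  contDiffAt : ContDiffAt ℝ 2 φ p
  eq_zero : φ p = 0
  gradient_ne_zero : gradient φ p ≠ 0
  eventually_mem_iff : ∀ᶠ x in 𝓝 p, (x ∈ Ω ↔ φ x < 0)

/-- The boundary of `Ω` is of class `C²`, with `Ω` lying locally on one side of it. -/
def HasC2Boundary {d : ℕ} (Ω : Set (EuclideanSpace ℝ (Fin d))) : Prop :=
  ∀ p ∈ frontier Ω, ∃ φ, IsLocalDefiningFunction Ω p φ

/-- `n` is the outward unit normal of `Ω` at the boundary point `p`, that is, the normalized
gradient at `p` of a local defining function (it does not depend on which one). -/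
def IsOutwardUnitNormal {d : ℕ} (Ω : Set (EuclideanSpace ℝ (Fin d)))
    (p n : EuclideanSpace ℝ (Fin d)) : Prop :=
  ∃ φ, IsLocalDefiningFunction Ω p φ ∧ n = ‖gradient φ p‖⁻¹ • gradient φ p

/-- `p` is a point of the boundary of `Ω` that is closest to `c`. -/
def IsClosestBoundaryPoint {d : ℕ} (Ω : Set (EuclideanSpace ℝ (Fin d)))
    (c p : EuclideanSpace ℝ (Fin d)) : Prop :=
  p ∈ frontier Ω ∧ ∀ y ∈ frontier Ω, dist c p ≤ dist c y

/-- A finite mesh in `ℝᵈ`: measurable elements that overlap at most in null sets, each with a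
centroid. All that is recorded of a centroid is that it lies in the convex hull of its element;
this holds for the mean of the vertices and for the center of mass. -/
structure Mesh (d : ℕ) where
  numElements : ℕ
  element : Fin numElements → Set (EuclideanSpace ℝ (Fin d))
  centroid : Fin numElements → EuclideanSpace ℝ (Fin d)
  measurableSet_element : ∀ e, MeasurableSet (element e)
  aedisjoint : Pairwise fun e e' => AEDisjoint volume (element e) (element e')
  centroid_mem : ∀ e, centroid e ∈ convexHull ℝ (element e)

/-- The elements of the mesh cover `Ω` up to a null set. -/
def Mesh.Covers {d : ℕ} (T : Mesh d) (Ω : Set (EuclideanSpace ℝ (Fin d))) : Prop :=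
  volume (Ω \ ⋃ e, T.element e) = 0

/-- The mesh resolves the boundary of `Ω` at size `h`: each element has diameter at most `h`,
except that elements whose bounding sphere about the centroid does not reach the boundary may be
of any size (adaptive subdivision stops there). -/
def Mesh.Resolves {d : ℕ} (T : Mesh d) (Ω : Set (EuclideanSpace ℝ (Fin d))) (h : ℝ) : Prop :=
  ∀ e, (Bornology.IsBounded (T.element e) ∧ diam (T.element e) ≤ h) ∨
    T.element e ⊆ ball (T.centroid e) (infDist (T.centroid e) (frontier Ω))

/-- The closed half-space through `p` with outward normal `n`: the set where the local linear
approximation `x ↦ (x - p) · n` of the signed distance is nonpositive. -/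
def halfSpace {d : ℕ} (p n : EuclideanSpace ℝ (Fin d)) : Set (EuclideanSpace ℝ (Fin d)) :=
  {x | inner ℝ (x - p) n ≤ 0}

/-- The inserted volume `V_h`: in every element `e` the geometry is replaced by the half-space
through `p e` with outward normal `n e`. -/
def Mesh.insertedVolume {d : ℕ} (T : Mesh d)
    (p n : Fin T.numElements → EuclideanSpace ℝ (Fin d)) : ℝ :=
  ∑ e, volume.real (T.element e ∩ halfSpace (p e) (n e))

end VolumeInsertion

end

/-!
At a point `p ∈ ∂Ω` closest to `c`, the ball about `c` through `p` lies on one side of `∂Ω`, so the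
outward normal at `p` is `±(p - c) / |p - c|` and the tangent half-space agrees with `Ω` on that
ball. Hence `Ω` and the half-space of an element can only disagree at points of the element outside
this ball, and these are within `2h` of `p`. If `φ` defines `Ω` near `p`, then at such a point `x`
the values `φ x` and `∇φ(p) · (x - p)` have opposite signs and differ by `O(h²)` by Taylor's
theorem, so `|φ x| = O(h²)`. The layer `{|φ| ≤ ε}` has volume `O(ε)` near a regular point, because
`φ` grows at least linearly along a suitable direction, so that many translates of the layer in this
direction are disjoint. As `∂Ω` is compact, the points of disagreement of all elements lie in a
single set of volume `O(h²)`.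
-/

open Set Filter
open scoped symmDiff NNReal ENNReal Pointwise

namespace VolumeInsertion

section Calculus

variable {E F : Type*} [NormedAddCommGroup E] [NormedSpace ℝ E]
  [NormedAddCommGroup F] [NormedSpace ℝ F]

theorem eventually_add_smul_lt_of_hasFDerivAt {f : E → ℝ} {f' : E →L[ℝ] ℝ} {p v : E}
    (hf : HasFDerivAt f f' p) (hv : f' v < 0) :
    ∀ᶠ t : ℝ in 𝓝[>] 0, f (p + t • v) < f p := by
  have hslope := (hf.hasLineDerivAt v).tendsto_slope_zero_right.eventually_lt_const hv
  filter_upwards [hslope, self_mem_nhdsWithin] with t ht (ht0 : 0 < t)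
  exact sub_neg.1 (neg_of_mul_neg_right ht (inv_nonneg.2 ht0.le))

theorem tendsto_add_smul_nhdsGT_zero (p v : E) :
    Tendsto (fun t : ℝ => p + t • v) (𝓝[>] 0) (𝓝 p) :=
  (Continuous.tendsto' (by fun_prop) _ _ (by simp)).mono_left nhdsWithin_le_nhds

theorem isBigO_sub_sub_fderiv_of_contDiffAt_two {f : E → F} {q : E} (hf : ContDiffAt ℝ 2 f q) :
    (fun z : E × E => f z.1 - f z.2 - fderiv ℝ f z.2 (z.1 - z.2))
      =O[𝓝 (q, q)] fun z => ‖z.1 - z.2‖ ^ 2 := by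
  have hf' : ContDiffAt ℝ 1 (fderiv ℝ f) q := hf.fderiv_right (by norm_num)
  obtain ⟨K, s, hs, hK⟩ := hf'.exists_lipschitzOnWith
  obtain ⟨r, hr, hball⟩ := Metric.eventually_nhds_iff_ball.1 ((hf.eventually (by simp)).and hs)
  refine .of_bound K ?_
  filter_upwards [ball_mem_nhds (q, q) hr] with ⟨x, y⟩ hxy
  rw [← ball_prod_same] at hxy
  obtain ⟨hx, hy⟩ : x ∈ ball q r ∧ y ∈ ball q r := hxy
  have hderiv : ∀ z ∈ ball q r ∩ closedBall y ‖x - y‖,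
      ‖fderiv ℝ f z - fderiv ℝ f y‖ ≤ K * ‖x - y‖ := fun z hz =>
    (hK.norm_sub_le (hball z hz.1).2 (hball y hy).2).trans
      (by gcongr; exact mem_closedBall_iff_norm.1 hz.2)
  have hmean := ((convex_ball q r).inter (convex_closedBall y ‖x - y‖))
    |>.norm_image_sub_le_of_norm_hasFDerivWithin_le'
      (fun z hz => ((hball z hz.1).1.differentiableAt (by norm_num)).hasFDerivAt.hasFDerivWithinAt)
      hderiv ⟨hy, by simp⟩ ⟨hx, by simp [dist_eq_norm]⟩
  simpa only [norm_pow, norm_norm, sq, mul_assoc, norm_mul] using hmean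

theorem eventually_mul_le_sub_of_hasStrictFDerivAt {f : E → ℝ} {f' : E →L[ℝ] ℝ} {q v : E} {c : ℝ}
    (hf : HasStrictFDerivAt f f' q) (hc : c < f' v) :
    ∀ᶠ z : E × E in 𝓝 (q, q), ∀ s : ℝ, 0 ≤ s → z.1 = s • v + z.2 → c * s ≤ f z.1 - f z.2 := by
  have hε : 0 < (f' v - c) / (‖v‖ + 1) := div_pos (sub_pos.2 hc) (by positivity)
  filter_upwards [hf.isLittleO.def hε] with ⟨x, y⟩ hxy s hs hx
  obtain rfl : x = s • v + y := hx
  have herror : |f (s • v + y) - f y - s * f' v| ≤ (f' v - c) / (‖v‖ + 1) * (s * ‖v‖) := by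
    simpa [norm_smul, abs_of_nonneg hs] using hxy
  have hsmall : (f' v - c) / (‖v‖ + 1) * (s * ‖v‖) ≤ (f' v - c) * s := by
    rw [div_mul_eq_mul_div, div_le_iff₀ (by positivity), mul_assoc]
    have := sub_pos.2 hc
    gcongr
    linarith
  linarith [(abs_le.1 herror).1]

end Calculus

section LevelSetLayer

theorem exists_norm_le_one_and_pos {E : Type*} [NormedAddCommGroup E] [NormedSpace ℝ E]
    {L : E →L[ℝ] ℝ} (hL : L ≠ 0) : ∃ v, ‖v‖ ≤ 1 ∧ 0 < L v := by
  obtain ⟨v, hv, hLv⟩ := L.exists_lt_apply_of_lt_opNorm (norm_pos_iff.2 hL)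
  rcases (norm_pos_iff.1 hLv).lt_or_gt with hneg | hpos
  · exact ⟨-v, (norm_neg v).trans_le hv.le, by simpa using hneg⟩
  · exact ⟨v, hv.le, hpos⟩

theorem pairwise_disjoint_mul_smul_vadd {E : Type*} [AddCommGroup E] [Module ℝ E] {A : Set E}
    {v : E} {t : ℝ} (ht : 0 ≤ t) (hA : ∀ x ∈ A, ∀ s, t ≤ s → s • v + x ∉ A) :
    Pairwise (Function.onFun Disjoint fun k : ℕ => ((k : ℝ) * t) • v +ᵥ A) := by
  refine (pairwise_disjoint_on _).2 fun i j hij => disjoint_left.2 ?_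
  rintro _ ⟨x, hx, rfl⟩ ⟨y, hy, hxy : ((j : ℝ) * t) • v + y = ((i : ℝ) * t) • v + x⟩
  have hgap : t ≤ ((j : ℝ) - i) * t := by
    have : (i : ℝ) + 1 ≤ j := by exact_mod_cast hij
    nlinarith
  have hshift : (((j : ℝ) - i) * t) • v + y = x := by
    rw [sub_mul, sub_smul, sub_add_eq_add_sub, hxy, add_sub_cancel_left]
  exact hA y hy _ hgap (hshift ▸ hx)

theorem card_mul_measure_le_of_pairwise_disjoint_vadd {G α ι : Type*} [Fintype ι] [AddGroup G]
    [AddAction G α] [MeasurableSpace α] [MeasurableConstVAdd G α] {μ : Measure α}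
    [VAddInvariantMeasure G α μ] {A B : Set α} {g : ι → G} (hA : MeasurableSet A)
    (hdisj : Pairwise (Function.onFun Disjoint fun i => g i +ᵥ A)) (hsub : ∀ i, g i +ᵥ A ⊆ B) :
    Fintype.card ι * μ A ≤ μ B :=
  calc Fintype.card ι * μ A = ∑ i, μ (g i +ᵥ A) := by simp [measure_vadd]
    _ = μ (⋃ i, g i +ᵥ A) := by
      rw [measure_iUnion hdisj fun i => hA.const_vadd (g i), tsum_fintype]
    _ ≤ μ B := measure_mono (iUnion_subset hsub)

variable {E : Type*} [NormedAddCommGroup E] [NormedSpace ℝ E] [MeasurableSpace E] [BorelSpace E]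
  (μ : Measure E) [μ.IsAddLeftInvariant]

theorem measure_le_of_forall_smul_add_notMem {A : Set E} {p v : E} {r t : ℝ} (hA : MeasurableSet A)
    (hAr : A ⊆ closedBall p r) (hv : ‖v‖ ≤ 1) (hr : 0 < r) (ht : 0 < t)
    (h : ∀ x ∈ A, ∀ s, t ≤ s → s • v + x ∉ A) :
    μ A ≤ ENNReal.ofReal (t / r) * μ (closedBall p (2 * r)) := by
  set N : ℕ := ⌊r / t⌋₊ + 1
  have hsub : ∀ k : Fin N, ((k : ℝ) * t) • v +ᵥ A ⊆ closedBall p (2 * r) := by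
    rintro k _ ⟨x, hx, rfl⟩
    have hk : (k : ℝ) * t ≤ r := by
      rw [← le_div_iff₀ ht]
      exact (Nat.cast_le.2 (Nat.lt_succ_iff.1 k.2)).trans (Nat.floor_le (by positivity))
    have hshift : ‖((k : ℝ) * t) • v‖ ≤ r := by
      rw [norm_smul, Real.norm_of_nonneg (by positivity)]
      exact (mul_le_of_le_one_right (by positivity) hv).trans hk
    rw [mem_closedBall_iff_norm, two_mul]
    change ‖((k : ℝ) * t) • v + x - p‖ ≤ r + r
    rw [add_sub_assoc]
    exact norm_add_le_of_le hshift (mem_closedBall_iff_norm.1 (hAr hx))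
  have hcard : N * μ A ≤ μ (closedBall p (2 * r)) := by
    simpa using card_mul_measure_le_of_pairwise_disjoint_vadd hA
      ((pairwise_disjoint_mul_smul_vadd ht.le h).comp_of_injective Fin.val_injective) hsub
  have hN : 1 ≤ ENNReal.ofReal (t / r) * N := by
    rw [← ENNReal.ofReal_natCast, ← ENNReal.ofReal_mul (by positivity), ENNReal.one_le_ofReal,
      ← div_le_iff₀' (by positivity), one_div_div]
    exact_mod_cast (Nat.lt_floor_add_one (r / t)).le
  calc μ A ≤ ENNReal.ofReal (t / r) * N * μ A := le_mul_of_one_le_left' hN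
    _ = ENNReal.ofReal (t / r) * (N * μ A) := mul_assoc _ _ _
    _ ≤ ENNReal.ofReal (t / r) * μ (closedBall p (2 * r)) := by gcongr

theorem exists_measure_inter_abs_le_le [ProperSpace E] [IsFiniteMeasureOnCompacts μ] {f : E → ℝ}
    {f' : E →L[ℝ] ℝ} {q : E} (hf : HasStrictFDerivAt f f' q) (hf' : f' ≠ 0) :
    ∃ U ∈ 𝓝 q, ∃ C : ℝ≥0, ∀ ε > 0, μ (U ∩ {x | |f x| ≤ ε}) ≤ C * ENNReal.ofReal ε := by
  obtain ⟨v, hv, hpos⟩ := exists_norm_le_one_and_pos hf'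
  set c := f' v / 2
  have hc : 0 < c := half_pos hpos
  obtain ⟨V, hVo, hqV, hgrowth⟩ := exists_nhds_square
    (eventually_mul_le_sub_of_hasStrictFDerivAt hf (half_lt_self hpos))
  obtain ⟨K, W, hW, hlip⟩ := hf.exists_lipschitzOnWith
  obtain ⟨r, hr, hball⟩ := nhds_basis_closedBall.mem_iff.1 (inter_mem (hVo.mem_nhds hqV) hW)
  have hcont : ContinuousOn f (closedBall q r) :=
    hlip.continuousOn.mono (hball.trans inter_subset_right)
  refine ⟨closedBall q r, closedBall_mem_nhds q hr,
    (3 / c / r).toNNReal * (μ (closedBall q (2 * r))).toNNReal, fun ε hε => ?_⟩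
  have hmeas : MeasurableSet (closedBall q r ∩ {x | |f x| ≤ ε}) :=
    (hcont.abs.preimage_isClosed_of_isClosed isClosed_closedBall isClosed_Iic).measurableSet
  have hescape : ∀ x ∈ closedBall q r ∩ {x | |f x| ≤ ε}, ∀ s, 3 * ε / c ≤ s →
      s • v + x ∉ closedBall q r ∩ {x | |f x| ≤ ε} := by
    rintro x ⟨hx, hfx : |f x| ≤ ε⟩ s hs ⟨hy, hfy : |f (s • v + x)| ≤ ε⟩
    have hgrow : c * s ≤ f (s • v + x) - f x :=
      hgrowth (mk_mem_prod (hball hy).1 (hball hx).1) s (le_trans (by positivity) hs) rfl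
    rw [div_le_iff₀' hc] at hs
    linarith [(abs_le.1 hfx).1, (abs_le.1 hfy).2]
  calc μ (closedBall q r ∩ {x | |f x| ≤ ε})
      ≤ ENNReal.ofReal (3 * ε / c / r) * μ (closedBall q (2 * r)) :=
        measure_le_of_forall_smul_add_notMem μ hmeas inter_subset_left hv hr (by positivity) hescape
    _ = ENNReal.ofReal (3 / c / r) * ENNReal.ofReal ε * μ (closedBall q (2 * r)) := by
      rw [← ENNReal.ofReal_mul (by positivity)]
      congr 2
      ring
    _ = _ := by
      rw [ENNReal.coe_mul, ENNReal.coe_toNNReal measure_closedBall_lt_top.ne, mul_right_comm]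
      rfl

end LevelSetLayer

section Direction

variable {E : Type*} [NormedAddCommGroup E] [InnerProductSpace ℝ E]

theorem sameRay_of_forall_inner_nonpos {u a : E}
    (h : ∀ v, inner ℝ u v < 0 → inner ℝ a v ≤ 0) : SameRay ℝ u a := by
  rcases eq_or_ne u 0 with rfl | hu
  · exact .zero_left a
  rcases eq_or_ne a 0 with rfl | ha
  · exact .zero_right u
  rw [← norm_pos_iff] at hu ha
  rw [sameRay_iff_norm_smul_eq, eq_comm, ← inner_eq_norm_mul_iff_real]
  refine (real_inner_le_norm u a).antisymm (not_lt.1 fun hlt => ?_)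
  have hua : inner ℝ u (‖u‖ • a - ‖a‖ • u) < 0 := by
    rw [inner_sub_right, inner_smul_right, inner_smul_right, real_inner_self_eq_norm_sq]
    nlinarith
  have haa := h _ hua
  rw [inner_sub_right, inner_smul_right, inner_smul_right, real_inner_self_eq_norm_sq,
    real_inner_comm] at haa
  nlinarith

theorem eventually_add_smul_mem_ball_dist {c p v : E} (h : inner ℝ (p - c) v < 0) :
    ∀ᶠ t : ℝ in 𝓝[>] 0, p + t • v ∈ ball c (dist c p) := by
  have hderiv := ((hasFDerivAt_id p).sub_const c).norm_sq
  have hlt := eventually_add_smul_lt_of_hasFDerivAt (v := v) hderiv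
    (by simpa [← inner_sub_left] using mul_neg_of_pos_of_neg two_pos h)
  filter_upwards [hlt] with t ht
  rw [mem_ball, dist_comm c p, dist_eq_norm, dist_eq_norm]
  exact lt_of_pow_lt_pow_left₀ 2 (norm_nonneg _) ht

theorem inner_sub_neg_of_mem_ball_dist {c p x : E} (hx : x ∈ ball c (dist c p)) :
    inner ℝ (x - p) (p - c) < 0 := by
  rw [dist_comm, mem_ball, dist_eq_norm, dist_eq_norm] at hx
  have hpc : 0 < ‖p - c‖ := (norm_nonneg _).trans_lt hx
  calc inner ℝ (x - p) (p - c) = inner ℝ (x - c) (p - c) - ‖p - c‖ * ‖p - c‖ := by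
        rw [← real_inner_self_eq_norm_mul_norm, ← inner_sub_left, sub_sub_sub_cancel_right]
    _ ≤ ‖x - c‖ * ‖p - c‖ - ‖p - c‖ * ‖p - c‖ := by gcongr; exact real_inner_le_norm _ _
    _ < 0 := sub_neg.2 (by gcongr)

end Direction

theorem subset_or_subset_compl_of_disjoint_frontier {X : Type*} [TopologicalSpace X] {s t : Set X}
    (hs : IsPreconnected s) (hst : Disjoint s (frontier t)) : s ⊆ t ∨ s ⊆ tᶜ := by
  have hcover : s ⊆ interior t ∪ interior tᶜ :=
    hst.subset_compl_right.trans compl_frontier_eq_union_interior.subset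
  have hdisj : Disjoint (interior t) (interior tᶜ) :=
    disjoint_compl_right.mono interior_subset interior_subset
  exact (hs.subset_or_subset isOpen_interior isOpen_interior hdisj hcover).imp
    (·.trans interior_subset) (·.trans interior_subset)

section Normal

variable {d : ℕ} {Ω : Set (EuclideanSpace ℝ (Fin d))} {c p n u v x : EuclideanSpace ℝ (Fin d)}
  {φ ψ : EuclideanSpace ℝ (Fin d) → ℝ}

namespace IsLocalDefiningFunction

theorem hasFDerivAt (hφ : IsLocalDefiningFunction Ω p φ) : HasFDerivAt φ (fderiv ℝ φ p) p :=
  (hφ.contDiffAt.differentiableAt (by norm_num)).hasFDerivAt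

theorem eventually_add_smul_mem (hφ : IsLocalDefiningFunction Ω p φ)
    (hv : inner ℝ (gradient φ p) v < 0) : ∀ᶠ t : ℝ in 𝓝[>] 0, p + t • v ∈ Ω := by
  rw [inner_gradient_left] at hv
  filter_upwards [eventually_add_smul_lt_of_hasFDerivAt hφ.hasFDerivAt hv,
    (tendsto_add_smul_nhdsGT_zero p v).eventually hφ.eventually_mem_iff] with t ht hmem
  exact hmem.2 (ht.trans_eq hφ.eq_zero)

theorem eventually_add_smul_notMem (hφ : IsLocalDefiningFunction Ω p φ)
    (hv : 0 < inner ℝ (gradient φ p) v) : ∀ᶠ t : ℝ in 𝓝[>] 0, p + t • v ∉ Ω := by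
  rw [inner_gradient_left] at hv
  filter_upwards [eventually_add_smul_lt_of_hasFDerivAt hφ.hasFDerivAt.neg (neg_neg_of_pos hv),
    (tendsto_add_smul_nhdsGT_zero p v).eventually hφ.eventually_mem_iff] with t ht hmem
  rw [hmem, not_lt, ← hφ.eq_zero]
  exact (neg_lt_neg_iff.1 ht).le

theorem sameRay_gradient_of_forall_eventually_mem (hφ : IsLocalDefiningFunction Ω p φ)
    (hu : ∀ v, inner ℝ u v < 0 → ∀ᶠ t : ℝ in 𝓝[>] 0, p + t • v ∈ Ω) :
    SameRay ℝ u (gradient φ p) := by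
  refine sameRay_of_forall_inner_nonpos fun v hv => not_lt.1 fun hpos => ?_
  obtain ⟨t, hmem, hnot⟩ := ((hu v hv).and (hφ.eventually_add_smul_notMem hpos)).exists
  exact hnot hmem

theorem sameRay_neg_gradient_of_forall_eventually_notMem (hφ : IsLocalDefiningFunction Ω p φ)
    (hu : ∀ v, inner ℝ u v < 0 → ∀ᶠ t : ℝ in 𝓝[>] 0, p + t • v ∉ Ω) :
    SameRay ℝ u (-gradient φ p) := by
  refine sameRay_of_forall_inner_nonpos fun v hv => ?_
  rw [inner_neg_left, neg_nonpos]
  refine not_lt.1 fun hneg => ?_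
  obtain ⟨t, hnot, hmem⟩ := ((hu v hv).and (hφ.eventually_add_smul_mem hneg)).exists
  exact hnot hmem

theorem sameRay_gradient (hφ : IsLocalDefiningFunction Ω p φ)
    (hψ : IsLocalDefiningFunction Ω p ψ) : SameRay ℝ (gradient φ p) (gradient ψ p) :=
  hψ.sameRay_gradient_of_forall_eventually_mem fun _ => hφ.eventually_add_smul_mem

theorem eventually_of_mem_frontier (hφ : IsLocalDefiningFunction Ω p φ) :
    ∀ᶠ y in 𝓝 p, y ∈ frontier Ω → IsLocalDefiningFunction Ω y φ := by
  have hgrad : ContinuousAt (gradient φ) p :=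
    (LinearIsometryEquiv.continuous _).continuousAt.comp
      (hφ.contDiffAt.fderiv_right (m := 1) (by norm_num)).continuousAt
  filter_upwards [hφ.contDiffAt.eventually (by simp), hφ.eventually_mem_iff.eventually_nhds,
    hgrad.eventually_ne hφ.gradient_ne_zero] with y hdiff hmem hne hy
  refine ⟨hdiff, le_antisymm (not_lt.1 fun hpos => ?_) (not_lt.1 fun hneg => ?_), hne, hmem⟩
  · obtain ⟨z, hzΩ, hz, hφz⟩ := ((mem_closure_iff_frequently.1 hy.1).and_eventually
      (hmem.and (hdiff.continuousAt.eventually (lt_mem_nhds hpos)))).exists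
    exact (hz.1 hzΩ).not_gt hφz
  · refine hy.2 (mem_interior_iff_mem_nhds.2 ?_)
    filter_upwards [hmem, hdiff.continuousAt.eventually (gt_mem_nhds hneg)] with z hz hφz
    exact hz.2 hφz

end IsLocalDefiningFunction

theorem IsOutwardUnitNormal.mem_halfSpace_iff (hn : IsOutwardUnitNormal Ω p n)
    (hφ : IsLocalDefiningFunction Ω p φ) : x ∈ halfSpace p n ↔ fderiv ℝ φ p (x - p) ≤ 0 := by
  obtain ⟨ψ, hψ, rfl⟩ := hn
  have hpos : 0 < ‖gradient φ p‖⁻¹ := inv_pos.2 (norm_pos_iff.2 hφ.gradient_ne_zero)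
  rw [(hψ.sameRay_gradient hφ).inv_norm_smul_eq hψ.gradient_ne_zero hφ.gradient_ne_zero,
    halfSpace, mem_ofPred_eq, inner_smul_right, real_inner_comm, inner_gradient_left]
  exact smul_nonpos_iff_nonpos_of_pos_left hpos

theorem IsClosestBoundaryPoint.disjoint_ball_frontier (hp : IsClosestBoundaryPoint Ω c p) :
    Disjoint (ball c (dist c p)) (frontier Ω) :=
  disjoint_left.2 fun y hy hyΩ => (hp.2 y hyΩ).not_gt (mem_ball'.1 hy)

theorem IsClosestBoundaryPoint.disjoint_ball_symmDiff_halfSpace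
    (hp : IsClosestBoundaryPoint Ω c p) (hn : IsOutwardUnitNormal Ω p n) :
    Disjoint (ball c (dist c p)) (Ω ∆ halfSpace p n) := by
  refine disjoint_left.2 fun x hx => ?_
  have hcp : p - c ≠ 0 := sub_ne_zero.2 (dist_pos.1 (pos_of_mem_ball hx)).symm
  have hinner := inner_sub_neg_of_mem_ball_dist hx
  obtain ⟨φ, hφ, -⟩ := id hn
  rw [mem_symmDiff, hn.mem_halfSpace_iff hφ, ← inner_gradient_left, real_inner_comm]
  rcases subset_or_subset_compl_of_disjoint_frontier (convex_ball _ _).isPreconnected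
    hp.disjoint_ball_frontier with hin | hout
  · obtain ⟨r, hr, hgrad⟩ := (hφ.sameRay_gradient_of_forall_eventually_mem fun v hv =>
      (eventually_add_smul_mem_ball_dist hv).mono fun t ht => hin ht).exists_pos_left hcp
        hφ.gradient_ne_zero
    have hneg : inner ℝ (x - p) (gradient φ p) < 0 := by
      rw [← hgrad, inner_smul_right]
      exact mul_neg_of_pos_of_neg hr hinner
    exact fun h => h.elim (fun h => h.2 hneg.le) fun h => h.2 (hin hx)
  · obtain ⟨r, hr, hgrad⟩ := (hφ.sameRay_neg_gradient_of_forall_eventually_notMem fun v hv =>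
      (eventually_add_smul_mem_ball_dist hv).mono fun t ht => hout ht).exists_pos_left hcp
        (neg_ne_zero.2 hφ.gradient_ne_zero)
    have hpos : 0 < inner ℝ (x - p) (gradient φ p) := by
      rw [← neg_neg (gradient φ p), ← hgrad, inner_neg_right, inner_smul_right]
      exact neg_pos.2 (mul_neg_of_pos_of_neg hr hinner)
    exact fun h => h.elim (fun h => hout hx h.1) fun h => hpos.not_ge h.1

end Normal

section TangentError

variable {d : ℕ} {Ω s t : Set (EuclideanSpace ℝ (Fin d))} {p q : EuclideanSpace ℝ (Fin d)} {ρ : ℝ}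
  {φ : EuclideanSpace ℝ (Fin d) → ℝ}

/-- The error of the tangent half-space approximation at scale `ρ`: the points within distance `ρ`
of some base point `p ∈ s` at which `Ω` differs from its tangent half-space at `p`. -/
def tangentErrorSet (Ω s : Set (EuclideanSpace ℝ (Fin d))) (ρ : ℝ) :
    Set (EuclideanSpace ℝ (Fin d)) :=
  {x | ∃ p ∈ s, ∃ n, IsOutwardUnitNormal Ω p n ∧ x ∈ closedBall p ρ ∩ Ω ∆ halfSpace p n}

theorem tangentErrorSet_empty : tangentErrorSet Ω ∅ ρ = ∅ := by
  simp [tangentErrorSet]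

theorem tangentErrorSet_mono (hst : s ⊆ t) : tangentErrorSet Ω s ρ ⊆ tangentErrorSet Ω t ρ :=
  fun _ ⟨p, hp, hx⟩ => ⟨p, hst hp, hx⟩

theorem tangentErrorSet_union :
    tangentErrorSet Ω (s ∪ t) ρ = tangentErrorSet Ω s ρ ∪ tangentErrorSet Ω t ρ := by
  ext x
  simp only [tangentErrorSet, mem_union, mem_ofPred_eq, or_and_right, exists_or]

theorem IsLocalDefiningFunction.exists_eventually_abs_le (hφ : IsLocalDefiningFunction Ω q φ) :
    ∃ M > 0, ∀ᶠ z in 𝓝 (q, q), z.2 ∈ frontier Ω → ∀ n, IsOutwardUnitNormal Ω z.2 n →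
      z.1 ∈ Ω ∆ halfSpace z.2 n → |φ z.1| ≤ M * ‖z.1 - z.2‖ ^ 2 := by
  obtain ⟨M, hM, htaylor⟩ := (isBigO_sub_sub_fderiv_of_contDiffAt_two hφ.contDiffAt).exists_pos
  refine ⟨M, hM, ?_⟩
  filter_upwards [htaylor.bound, hφ.eventually_mem_iff.prod_inl_nhds q,
    hφ.eventually_of_mem_frontier.prod_inr_nhds q] with ⟨x, p⟩ hbound hmem hloc hp n hn hx
  have hφp := hloc hp
  simp only [hφp.eq_zero, sub_zero, norm_pow, norm_norm] at hbound
  refine le_trans ?_ hbound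
  rw [mem_symmDiff, hmem, hn.mem_halfSpace_iff hφp, not_le, not_lt] at hx
  rcases hx with ⟨hneg, hpos⟩ | ⟨hnonpos, hnonneg⟩
  · rw [abs_of_neg hneg, Real.norm_of_nonpos (by linarith)]
    linarith
  · rw [abs_of_nonneg hnonneg, Real.norm_of_nonneg (by linarith)]
    linarith

theorem IsLocalDefiningFunction.exists_volume_tangentErrorSet_le
    (hφ : IsLocalDefiningFunction Ω q φ) :
    ∃ s ∈ 𝓝[frontier Ω] q, ∃ C : ℝ≥0, ∀ᶠ ρ in 𝓝[>] (0 : ℝ),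
      volume (tangentErrorSet Ω s ρ) ≤ C * ENNReal.ofReal (ρ ^ 2) := by
  have hfderiv : fderiv ℝ φ q ≠ 0 := fun h0 => hφ.gradient_ne_zero (by simp [gradient, h0])
  obtain ⟨U, hU, A, hvol⟩ := exists_measure_inter_abs_le_le volume
    (hφ.contDiffAt.hasStrictFDerivAt (by norm_num)) hfderiv
  obtain ⟨M, hM, herr⟩ := hφ.exists_eventually_abs_le
  obtain ⟨r, hr, hball⟩ := Metric.eventually_nhds_iff_ball.1
    (herr.and (Eventually.prod_inl_nhds hU q))
  refine ⟨frontier Ω ∩ ball q (r / 2), inter_mem_nhdsWithin _ (ball_mem_nhds q (half_pos hr)),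
    A * M.toNNReal, ?_⟩
  filter_upwards [Ioo_mem_nhdsGT (half_pos hr)] with ρ ⟨hρ0, hρr⟩
  have hsub : tangentErrorSet Ω (frontier Ω ∩ ball q (r / 2)) ρ ⊆ U ∩ {x | |φ x| ≤ M * ρ ^ 2} := by
    rintro x ⟨p, ⟨hp, hpq⟩, n, hn, hxp, hx⟩
    have hxq : x ∈ ball q r :=
      ((dist_triangle x p q).trans_lt (add_lt_add_of_le_of_lt hxp hpq)).trans (by linarith)
    have hxp' : (x, p) ∈ ball (q, q) r :=
      ball_prod_same q q r ▸ mk_mem_prod hxq (ball_subset_ball (by linarith) hpq)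
    obtain ⟨habs, hxU⟩ := hball _ hxp'
    refine ⟨hxU, (habs hp n hn hx).trans ?_⟩
    gcongr
    exact mem_closedBall_iff_norm.1 hxp
  calc volume (tangentErrorSet Ω (frontier Ω ∩ ball q (r / 2)) ρ)
      ≤ A * ENNReal.ofReal (M * ρ ^ 2) := (measure_mono hsub).trans (hvol _ (by positivity))
    _ = ↑(A * M.toNNReal) * ENNReal.ofReal (ρ ^ 2) := by
      rw [ENNReal.ofReal_mul hM.le, ENNReal.coe_mul, mul_assoc]
      rfl

theorem HasC2Boundary.exists_volume_tangentErrorSet_le (hΩ : HasC2Boundary Ω)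
    (hcomp : IsCompact (frontier Ω)) :
    ∃ C : ℝ≥0, ∀ᶠ ρ in 𝓝[>] (0 : ℝ),
      volume (tangentErrorSet Ω (frontier Ω) ρ) ≤ C * ENNReal.ofReal (ρ ^ 2) := by
  refine hcomp.induction_on (p := fun s => ∃ C : ℝ≥0, ∀ᶠ ρ in 𝓝[>] (0 : ℝ),
      volume (tangentErrorSet Ω s ρ) ≤ C * ENNReal.ofReal (ρ ^ 2)) ?_ ?_ ?_ ?_
  · exact ⟨0, by simp [tangentErrorSet_empty]⟩
  · rintro s t hst ⟨C, hC⟩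
    exact ⟨C, hC.mono fun ρ hρ => (measure_mono (tangentErrorSet_mono hst)).trans hρ⟩
  · rintro s t ⟨C, hC⟩ ⟨C', hC'⟩
    refine ⟨C + C', (hC.and hC').mono fun ρ ⟨hρ, hρ'⟩ => ?_⟩
    rw [tangentErrorSet_union, ENNReal.coe_add, add_mul]
    exact (measure_union_le _ _).trans (add_le_add hρ hρ')
  · intro q hq
    obtain ⟨φ, hφ⟩ := hΩ q hq
    exact hφ.exists_volume_tangentErrorSet_le

end TangentError

namespace Mesh

variable {d : ℕ} {Ω : Set (EuclideanSpace ℝ (Fin d))} {T : Mesh d} {h : ℝ}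

theorem Resolves.isBounded_element (hT : T.Resolves Ω h) (e : Fin T.numElements) :
    Bornology.IsBounded (T.element e) :=
  (hT e).elim And.left isBounded_ball.subset

theorem Resolves.element_inter_symmDiff_subset_closedBall (hT : T.Resolves Ω h)
    {e : Fin T.numElements} {p n : EuclideanSpace ℝ (Fin d)}
    (hp : IsClosestBoundaryPoint Ω (T.centroid e) p) (hn : IsOutwardUnitNormal Ω p n) :
    T.element e ∩ Ω ∆ halfSpace p n ⊆ closedBall p (2 * h) := by
  rintro x ⟨hxe, hx⟩
  have hcp : dist (T.centroid e) p ≤ dist x (T.centroid e) := by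
    rw [← not_lt, ← mem_ball]
    exact disjoint_right.1 (hp.disjoint_ball_symmDiff_halfSpace hn) hx
  rcases hT e with ⟨hbdd, hdiam⟩ | hsub
  · have hxc : dist x (T.centroid e) ≤ h :=
      (dist_le_diam_of_mem (isBounded_convexHull.2 hbdd) (subset_convexHull ℝ _ hxe)
        (T.centroid_mem e)).trans ((convexHull_diam _).trans_le hdiam)
    rw [mem_closedBall]
    linarith [dist_triangle x (T.centroid e) p]
  · exact absurd ((mem_ball.1 (hsub hxe)).trans_le (infDist_le_dist_of_mem hp.1)) hcp.not_gt

/-- The discretized geometry, of volume `V_h`: the union over the elements of the part of the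
element that lies in its half-space. -/
def insertedRegion (T : Mesh d) (p n : Fin T.numElements → EuclideanSpace ℝ (Fin d)) :
    Set (EuclideanSpace ℝ (Fin d)) :=
  ⋃ e, T.element e ∩ halfSpace (p e) (n e)

variable {p n : Fin T.numElements → EuclideanSpace ℝ (Fin d)}

theorem measurableSet_element_inter_halfSpace (e : Fin T.numElements) :
    MeasurableSet (T.element e ∩ halfSpace (p e) (n e)) :=
  (T.measurableSet_element e).inter (isClosed_le (by fun_prop) continuous_const).measurableSet

theorem volume_real_insertedRegion (hfin : ∀ e, volume (T.element e) ≠ ∞) :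
    volume.real (T.insertedRegion p n) = T.insertedVolume p n := by
  have hsum := measureReal_biUnion_finset₀ (s := Finset.univ)
    (fun e _ e' _ hne => (T.aedisjoint hne).mono inter_subset_left inter_subset_left)
    (fun e _ => (measurableSet_element_inter_halfSpace (p := p) (n := n) e).nullMeasurableSet)
    fun e _ => measure_ne_top_of_subset inter_subset_left (hfin e)
  simpa [insertedRegion, insertedVolume] using hsum

theorem Covers.symmDiff_insertedRegion_ae_subset (hT : T.Covers Ω) :
    Ω ∆ T.insertedRegion p n ≤ᵐ[volume] ⋃ e, T.element e ∩ Ω ∆ halfSpace (p e) (n e) := by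
  filter_upwards [ae_le_set.2 hT] with x hcover hx
  rcases hx with ⟨hxΩ, hxR⟩ | ⟨hxR, hxΩ⟩
  · obtain ⟨e, he⟩ := mem_iUnion.1 (hcover hxΩ)
    exact mem_iUnion.2 ⟨e, he, .inl ⟨hxΩ, fun hH => hxR (mem_iUnion.2 ⟨e, he, hH⟩)⟩⟩
  · obtain ⟨e, he, hH⟩ := mem_iUnion.1 hxR
    exact mem_iUnion.2 ⟨e, he, .inr ⟨hH, hxΩ⟩⟩

theorem abs_volume_real_sub_insertedVolume_le (hΩ : NullMeasurableSet Ω) (hΩfin : volume Ω ≠ ∞)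
    (hfin : ∀ e, volume (T.element e) ≠ ∞) :
    |volume.real Ω - T.insertedVolume p n| ≤ volume.real (Ω ∆ T.insertedRegion p n) := by
  rw [← volume_real_insertedRegion hfin]
  refine abs_measureReal_sub_le_measureReal_symmDiff' hΩ
    (MeasurableSet.iUnion measurableSet_element_inter_halfSpace).nullMeasurableSet hΩfin ?_
  exact ne_top_of_le_ne_top
    (ENNReal.sum_ne_top.2 fun e _ => measure_ne_top_of_subset inter_subset_left (hfin e))
    (measure_iUnion_fintype_le _ _)

theorem Resolves.volume_symmDiff_insertedRegion_le (hres : T.Resolves Ω h) (hcov : T.Covers Ω)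
    (hp : ∀ e, IsClosestBoundaryPoint Ω (T.centroid e) (p e))
    (hn : ∀ e, IsOutwardUnitNormal Ω (p e) (n e)) :
    volume (Ω ∆ T.insertedRegion p n) ≤ volume (tangentErrorSet Ω (frontier Ω) (2 * h)) := by
  refine measure_mono_ae (hcov.symmDiff_insertedRegion_ae_subset.trans
    (LE.le.eventuallyLE (iUnion_subset fun e x hx => ?_)))
  exact ⟨p e, (hp e).1, n e, hn e,
    hres.element_inter_symmDiff_subset_closedBall (hp e) (hn e) hx, hx.2⟩

end Mesh

end VolumeInsertion

theorem mainTheorem1 {d : ℕ} (Ω : Set (EuclideanSpace ℝ (Fin d)))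
    (hΩ_open : IsOpen Ω) (hΩ_bdd : Bornology.IsBounded Ω)
    (hΩ_C2 : VolumeInsertion.HasC2Boundary Ω) :
    ∃ C h₀ : ℝ, 0 < C ∧ 0 < h₀ ∧
      ∀ h : ℝ, 0 < h → h ≤ h₀ →
      ∀ T : VolumeInsertion.Mesh d, T.Covers Ω → T.Resolves Ω h →
      ∀ p n : Fin T.numElements → EuclideanSpace ℝ (Fin d),
        (∀ e, VolumeInsertion.IsClosestBoundaryPoint Ω (T.centroid e) (p e)) →
        (∀ e, VolumeInsertion.IsOutwardUnitNormal Ω (p e) (n e)) →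
        |volume.real Ω - T.insertedVolume p n| ≤ C * h ^ 2 := by
  have hcomp : IsCompact (frontier Ω) :=
    hΩ_bdd.isCompact_closure.of_isClosed_subset isClosed_frontier frontier_subset_closure
  obtain ⟨C, hC⟩ := hΩ_C2.exists_volume_tangentErrorSet_le hcomp
  obtain ⟨δ, hδ, hlocal⟩ := mem_nhdsGT_iff_exists_Ioc_subset.1 hC
  refine ⟨4 * C + 1, δ / 2, by positivity, half_pos hδ, fun h h0 hh T hcov hres p n hp hn => ?_⟩
  have herr : volume (Ω ∆ T.insertedRegion p n) ≤ ENNReal.ofReal (C * (2 * h) ^ 2) := by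
    rw [ENNReal.ofReal_mul C.coe_nonneg, ENNReal.ofReal_coe_nnreal]
    exact (hres.volume_symmDiff_insertedRegion_le hcov hp hn).trans
      (hlocal ⟨by positivity, by linarith⟩)
  calc |volume.real Ω - T.insertedVolume p n|
      ≤ volume.real (Ω ∆ T.insertedRegion p n) :=
        VolumeInsertion.Mesh.abs_volume_real_sub_insertedVolume_le
          hΩ_open.measurableSet.nullMeasurableSet hΩ_bdd.measure_lt_top.ne
          fun e => (hres.isBounded_element e).measure_lt_top.ne
    _ ≤ C * (2 * h) ^ 2 := ENNReal.toReal_le_of_le_ofReal (by positivity) herr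
    _ ≤ (4 * C + 1) * h ^ 2 := by nlinarith [sq_nonneg h]
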